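/- For an immersed closed plane curve with arc-length parameter $s$, length $L$, unit tangent $\tau$, unit normal $\nu$ ($\tau$ rotated counter-clockwise by $\pi/2$) and signed curvature $\kappa$, put $$\tilde\kappa=\kappa-\frac1L\int_0^L\kappa\,ds,\qquad A=-\frac12\int_0^L \mathbf f\cdot\nu\,ds,\qquad n=\frac1{2\pi}\int_0^L\kappa\,ds,\qquad I_{-1}=1-\frac{4\pi nA}{L^2}.$$ Consider the flow $\partial_t\mathbf f=\bigl(\tilde\kappa-\frac gL\bigr)\nu$ of closed plane curves, where $\mathbf f=\mathbf f(u,t)$ with $u$ a fixed ($t$-independent) periodic curve parameter, $\partial_t$ is taken at fixed $u$, and $g$ is one of - (AP) $g=0$; - (LP) $g=L\left(\int_0^L\kappa\,ds\right)^{-1}\int_0^L\tilde\kappa^2\,ds$; - (JP) $g=\frac{L^2}{2A}-\int_0^L\kappa\,ds$. Let $\mathbf f$ be a classical solution of (AP), (LP) or (JP) on $[0,T)$, i.e. a family of immersed closed curves with $\mathbf f,\partial_u\mathbf f,\partial_u^2\mathbf f,\partial_t\mathbf f$ continuous on $[0,T)$ that satisfies the equation (in particular the denominator in $g$ does not vanish),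 and let $T\in(0,\infty]$ be its maximal existence time, i.e. $\mathbf f$ does not extend to a classical solution on a longer interval. Assume that the initial curve is smooth, has rotation number $n\ge1$, satisfies $A(0)>0$ and $I_{-1}(0)=0$, and is not an $n$-fold circle (that is, not of the form $a+b\,e^{2\pi i n s/L}$, $b\ne0$, in its arc-length parameter, with $\mathbb R^2=\mathbb C$). Then $T<\infty$. -/

import Mathlib

open scoped ContDiff

noncomputable section

namespace CurveFlow

/-! Closed plane curves are `1`-periodic maps `γ : ℝ → ℂ`, the plane `ℝ²` being identified with `ℂ`.
The arc-length parameter `s` of `γ` is given by `ds = ‖γ'(u)‖ du`. -/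

/-- The speed `ds/du`. -/
def speed (γ : ℝ → ℂ) (u : ℝ) : ℝ := ‖deriv γ u‖

/-- The arc-length parameter measured from `u = 0`. -/
def arcLength (γ : ℝ → ℂ) (u : ℝ) : ℝ := ∫ v in (0 : ℝ)..u, speed γ v

/-- The total length `L` of the closed curve. -/
def length (γ : ℝ → ℂ) : ℝ := ∫ u in (0 : ℝ)..1, speed γ u

/-- The arc-length derivative `∂ₛ h` of a function `h` on the curve. -/
def arcDeriv (γ h : ℝ → ℂ) (u : ℝ) : ℂ := (speed γ u)⁻¹ • deriv h u

/-- The integral `∫₀ᴸ h ds` of a function `h` along the closed curve. -/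
def arcIntegral (γ : ℝ → ℂ) (h : ℝ → ℝ) : ℝ := ∫ u in (0 : ℝ)..1, h u * speed γ u

/-- The unit tangent vector `τ = ∂ₛ γ`. -/
def tangent (γ : ℝ → ℂ) : ℝ → ℂ := arcDeriv γ γ

/-- The unit normal vector `ν`: the tangent rotated counter-clockwise by `π / 2`. -/
def normal (γ : ℝ → ℂ) (u : ℝ) : ℂ := Complex.I * tangent γ u

/-- The curvature vector `∂ₛ² γ`. -/
def curvatureVector (γ : ℝ → ℂ) : ℝ → ℂ := arcDeriv γ (tangent γ)

/-- The signed curvature `κ`, the Euclidean inner product of the curvature vector with `ν`. -/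
def curvature (γ : ℝ → ℂ) (u : ℝ) : ℝ := inner ℝ (curvatureVector γ u) (normal γ u)

/-- The total curvature `∫₀ᴸ κ ds`. -/
def totalCurvature (γ : ℝ → ℂ) : ℝ := arcIntegral γ (curvature γ)

/-- The deviation `κ - (1 / L) ∫₀ᴸ κ ds` of the curvature from its mean. -/
def curvatureDeviation (γ : ℝ → ℂ) (u : ℝ) : ℝ :=
  curvature γ u - (1 / length γ) * totalCurvature γ

/-- The rotation number `(1 / 2π) ∫₀ᴸ κ ds`. -/
def rotationNumber (γ : ℝ → ℂ) : ℝ := (1 / (2 * Real.pi)) * totalCurvature γ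

/-- The signed area `A = -(1 / 2) ∫₀ᴸ γ · ν ds`. -/
def area (γ : ℝ → ℂ) : ℝ := -(1 / 2) * arcIntegral γ (fun u => inner ℝ (γ u) (normal γ u))

/-- The isoperimetric deficit `I₋₁ = 1 - 4 π n A / L²`, with `n` the rotation number. -/
def isoperimetricDeficit (γ : ℝ → ℂ) : ℝ :=
  1 - 4 * Real.pi * rotationNumber γ * area γ / length γ ^ 2

/-- The curve is an `n`-fold circle: in the arc-length parameter `s` it is
`a + b exp (2 π i n s / L)` with `b ≠ 0`. -/
def IsFoldCircle (n : ℕ) (γ : ℝ → ℂ) : Prop :=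
  ∃ a b : ℂ, b ≠ 0 ∧ ∀ u : ℝ,
    γ u = a + b * Complex.exp
      (((2 * Real.pi * n * (arcLength γ u / length γ) : ℝ) : ℂ) * Complex.I)

/-- The three non-local flows: area preserving, length preserving, and Jiang–Pan. -/
inductive FlowType
  | AP
  | LP
  | JP

/-- The non-local quantity `g` of each flow. -/
def forcing : FlowType → (ℝ → ℂ) → ℝ
  | .AP, _ => 0
  | .LP, γ =>
      length γ * (totalCurvature γ)⁻¹ * arcIntegral γ (fun u => curvatureDeviation γ u ^ 2)
  | .JP, γ => length γ ^ 2 / (2 * area γ) - totalCurvature γ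

/-- The denominator in the definition of `g` does not vanish. -/
def ForcingDefined : FlowType → (ℝ → ℂ) → Prop
  | .AP, _ => True
  | .LP, γ => totalCurvature γ ≠ 0
  | .JP, γ => area γ ≠ 0

/-- The times `t` with `0 ≤ t < T`, where `T` may be `∞`. -/
def timeInterval (T : EReal) : Set ℝ := {t | 0 ≤ t ∧ (t : EReal) < T}

/-- `f t u` (time `t`, curve parameter `u`) is a classical solution on `[0, T)` of
`∂ₜ f = (κ - (1 / L) ∫ κ ds - g / L) ν`: a family of immersed closed curves for which `f`, `∂ᵤ f`,
`∂ᵤ² f` are continuous on `[0, T) × ℝ`, and for which the equation holds at every point, `∂ₜ` being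
taken at fixed `u` (one-sided at `t = 0`). Continuity of `∂ₜ f` then follows from the equation. -/
structure IsClassicalSolution (F : FlowType) (T : EReal) (f : ℝ → ℝ → ℂ) : Prop where
  periodic : ∀ t ∈ timeInterval T, Function.Periodic (f t) 1
  contDiff : ∀ t ∈ timeInterval T, ContDiff ℝ 2 (f t)
  immersed : ∀ t ∈ timeInterval T, ∀ u, deriv (f t) u ≠ 0
  continuousOn : ∀ k ≤ 2,
    ContinuousOn (fun p : ℝ × ℝ => iteratedDeriv k (f p.1) p.2) (timeInterval T ×ˢ Set.univ)
  forcingDefined : ∀ t ∈ timeInterval T, ForcingDefined F (f t)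
  equation : ∀ t ∈ timeInterval T, ∀ u,
    HasDerivWithinAt (fun t' => f t' u)
      ((curvatureDeviation (f t) u - forcing F (f t) / length (f t)) • normal (f t) u)
      (Set.Ici 0) t

/-- `f` is a classical solution on `[0, T)`, and `T ∈ (0, ∞]` is its maximal existence time: `f`
does not extend to a classical solution on a longer interval. -/
structure IsMaximalSolution (F : FlowType) (T : EReal) (f : ℝ → ℝ → ℂ) : Prop where
  pos : 0 < T
  solution : IsClassicalSolution F T f
  maximal : ∀ T' : EReal, T < T' →
    ¬ ∃ f' : ℝ → ℝ → ℂ, IsClassicalSolution F T' f' ∧ ∀ t ∈ timeInterval T, f' t = f t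

end CurveFlow

end

namespace CurveFlow

open Filter Topology

/-! Suppose the solution were global, and write `K = ∫ κ̃² ds`, `c = ∫ κ ds`, `I` for the deficit.
The total curvature `c` is a continuous function of time with values in `2πℤ`, hence constant. The
first variation formulas give `L' = -(K - c g / L)` and `A' = g`, so `I' = -(2c / L²) (g I + 2 A K /
L)`.

For each of the three flows the bracket is nonnegative, so `I` is nonincreasing. At time `0` it
equals `2 A K / L > 0`, because `I = 0`, `A > 0` and a curve that is not an `n`-fold circle has `K >
0`. Hence `I ≤ -δ < 0` from some time on.

The geometric input is `I² ≤ L K` (`sq_isoperimetricDeficit_le`), valid without any convexity or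
embeddedness; it turns `I ≤ -δ` into `L K ≥ δ²`. Then `L²` decreases at a definite rate (AP, JP), or
`A` grows at a definite rate while `L` stays constant (LP), against `L > 0` or the bound `A ≤ L² /
2`.

Only two derivatives in `u` and one in `t` are available, with no mixed derivative, so `L` and `A`
are differentiated through convexity and polarization instead of under the integral sign. -/

/-- A `1`-periodic immersed plane curve of class `C²`. -/
structure IsClosedImmersion (γ : ℝ → ℂ) : Prop where
  periodic : Function.Periodic γ 1
  contDiff : ContDiff ℝ 2 γ
  immersed : ∀ u, deriv γ u ≠ 0

/-! ### Plane linear algebra and integration by parts -/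

theorem periodic_deriv {h : ℝ → ℂ} (hp : Function.Periodic h 1) :
    Function.Periodic (deriv h) 1 := by
  intro u
  rw [← deriv_comp_add_const h 1 u]
  congr 1
  funext x
  exact hp x

theorem inner_I_mul_right (a b : ℂ) : inner ℝ a (Complex.I * b) = -inner ℝ (Complex.I * a) b := by
  simp [Complex.inner]
  ring

theorem inner_I_mul_self (a : ℂ) : inner ℝ a (Complex.I * a) = 0 := by
  simp [Complex.inner]
  ring

theorem eq_inner_smul_of_inner_eq_zero {a z : ℂ} (ha : ‖a‖ = 1) (h : inner ℝ z a = 0) :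
    z = (inner ℝ z (Complex.I * a) : ℝ) • (Complex.I * a) := by
  have h1 : a.re * a.re + a.im * a.im = 1 := by
    have := Complex.sq_norm a
    rw [ha, Complex.normSq_apply] at this
    linarith
  simp only [Complex.inner, Complex.mul_re, Complex.conj_re, Complex.conj_im] at h
  apply Complex.ext <;> simp [Complex.inner]
  · linear_combination a.re * h - z.re * h1
  · linear_combination a.im * h - z.im * h1

/-- Integration by parts along a closed curve. -/
theorem integral_inner_deriv_eq_neg {a b a' b' : ℝ → ℂ} (ha : ∀ u, HasDerivAt a (a' u) u)
    (hb : ∀ u, HasDerivAt b (b' u) u) (ca : Continuous a') (cb : Continuous b')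
    (pa : Function.Periodic a 1) (pb : Function.Periodic b 1) :
    ∫ u in (0 : ℝ)..1, inner ℝ (a u) (b' u) = -∫ u in (0 : ℝ)..1, inner ℝ (a' u) (b u) := by
  have ca0 : Continuous a := continuous_iff_continuousAt.2 fun u => (ha u).continuousAt
  have cb0 : Continuous b := continuous_iff_continuousAt.2 fun u => (hb u).continuousAt
  have h : ∫ u in (0 : ℝ)..1, (inner ℝ (a u) (b' u) + inner ℝ (a' u) (b u))
      = inner ℝ (a 1) (b 1) - inner ℝ (a 0) (b 0) :=
    intervalIntegral.integral_eq_sub_of_hasDerivAt (fun u _ => (ha u).inner ℝ (hb u))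
      (by apply Continuous.intervalIntegrable; fun_prop)
  rw [intervalIntegral.integral_add (by apply Continuous.intervalIntegrable; fun_prop)
    (by apply Continuous.intervalIntegrable; fun_prop)] at h
  have h1 := pa 0
  have h2 := pb 0
  rw [zero_add] at h1 h2
  rw [h1, h2] at h
  linarith

theorem norm_sub_le_integral_norm_deriv {h h' : ℝ → ℂ} (hh : ∀ u, HasDerivAt h (h' u) u)
    (ch : Continuous h') {u : ℝ} (hu : u ∈ Set.Icc (0 : ℝ) 1) :
    ‖h u - h 0‖ ≤ ∫ v in (0 : ℝ)..1, ‖h' v‖ := by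
  rw [← intervalIntegral.integral_eq_sub_of_hasDerivAt (fun v _ => hh v)
    (ch.intervalIntegrable _ _)]
  refine (intervalIntegral.norm_integral_le_integral_norm hu.1).trans ?_
  exact intervalIntegral.integral_mono_interval le_rfl hu.1 hu.2
    (Filter.Eventually.of_forall fun _ => norm_nonneg _) (ch.norm.intervalIntegrable _ _)

theorem isoperimetricDeficit_eq (γ : ℝ → ℂ) :
    isoperimetricDeficit γ = 1 - 2 * totalCurvature γ * area γ / length γ ^ 2 := by
  rw [isoperimetricDeficit, rotationNumber]
  field_simp
  ring

/-! ### Geometry of a single closed curve -/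

namespace IsClosedImmersion

variable {γ : ℝ → ℂ}

theorem speed_pos (hγ : IsClosedImmersion γ) (u : ℝ) : 0 < speed γ u :=
  norm_pos_iff.2 (hγ.immersed u)

theorem hasDerivAt (hγ : IsClosedImmersion γ) (u : ℝ) : HasDerivAt γ (deriv γ u) u :=
  (hγ.contDiff.differentiable (by norm_num) u).hasDerivAt

theorem contDiff_deriv (hγ : IsClosedImmersion γ) : ContDiff ℝ 1 (deriv γ) :=
  ((contDiff_succ_iff_deriv (n := 1)).1 hγ.contDiff).2.2

theorem continuous_deriv (hγ : IsClosedImmersion γ) : Continuous (deriv γ) :=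
  hγ.contDiff_deriv.continuous

theorem continuous (hγ : IsClosedImmersion γ) : Continuous γ := hγ.contDiff.continuous

theorem continuous_iteratedDeriv_two (hγ : IsClosedImmersion γ) :
    Continuous (iteratedDeriv 2 γ) := hγ.contDiff.continuous_iteratedDeriv 2 le_rfl

theorem hasDerivAt_deriv (hγ : IsClosedImmersion γ) (u : ℝ) :
    HasDerivAt (deriv γ) (iteratedDeriv 2 γ u) u := by
  rw [iteratedDeriv_succ, iteratedDeriv_one]
  exact (hγ.contDiff_deriv.differentiable (by norm_num) u).hasDerivAt

theorem continuous_speed (hγ : IsClosedImmersion γ) : Continuous (speed γ) :=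
  hγ.continuous_deriv.norm

theorem contDiff_speed (hγ : IsClosedImmersion γ) : ContDiff ℝ 1 (speed γ) :=
  hγ.contDiff_deriv.norm ℝ hγ.immersed

theorem contDiff_tangent (hγ : IsClosedImmersion γ) : ContDiff ℝ 1 (tangent γ) :=
  (hγ.contDiff_speed.inv fun u => (hγ.speed_pos u).ne').smul hγ.contDiff_deriv

theorem continuous_tangent (hγ : IsClosedImmersion γ) : Continuous (tangent γ) :=
  hγ.contDiff_tangent.continuous

theorem continuous_normal (hγ : IsClosedImmersion γ) : Continuous (normal γ) :=
  continuous_const.mul hγ.continuous_tangent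

theorem norm_tangent (hγ : IsClosedImmersion γ) (u : ℝ) : ‖tangent γ u‖ = 1 := by
  rw [tangent, arcDeriv, norm_smul, norm_inv, Real.norm_of_nonneg (hγ.speed_pos u).le]
  exact inv_mul_cancel₀ (hγ.speed_pos u).ne'

theorem norm_normal (hγ : IsClosedImmersion γ) (u : ℝ) : ‖normal γ u‖ = 1 := by
  simp [normal, hγ.norm_tangent u]

theorem speed_smul_tangent (hγ : IsClosedImmersion γ) (u : ℝ) :
    speed γ u • tangent γ u = deriv γ u := by
  rw [tangent, arcDeriv, smul_inv_smul₀ (hγ.speed_pos u).ne']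

theorem speed_smul_normal (hγ : IsClosedImmersion γ) (u : ℝ) :
    speed γ u • normal γ u = Complex.I * deriv γ u := by
  rw [normal, ← mul_smul_comm, hγ.speed_smul_tangent]

/-- The Frenet equation `∂ₛ τ = κ ν`. -/
theorem hasDerivAt_tangent (hγ : IsClosedImmersion γ) (u : ℝ) :
    HasDerivAt (tangent γ) ((curvature γ u * speed γ u) • normal γ u) u := by
  have h := (hγ.contDiff_tangent.differentiable (by norm_num) u).hasDerivAt
  have h1 : inner ℝ (deriv (tangent γ) u) (tangent γ u) = 0 := by
    have h2 := h.inner ℝ h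
    have h3 : (fun t => inner ℝ (tangent γ t) (tangent γ t)) = fun _ => (1 : ℝ) := by
      funext t
      rw [real_inner_self_eq_norm_sq, hγ.norm_tangent]
      norm_num
    rw [h3] at h2
    have h4 := h2.unique (hasDerivAt_const u (1 : ℝ))
    rw [real_inner_comm] at h4
    linarith
  have h5 := eq_inner_smul_of_inner_eq_zero (hγ.norm_tangent u) h1
  have h6 : curvature γ u * speed γ u
      = inner ℝ (deriv (tangent γ) u) (Complex.I * tangent γ u) := by
    rw [curvature, curvatureVector, arcDeriv, real_inner_smul_left, normal]
    field_simp [(hγ.speed_pos u).ne']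
  rw [h6, normal, ← h5]
  exact h

/-- Pairing the derivative of `γ' = |γ'| τ` with `ν` isolates the curvature term. The formula
involves only the first two `u`-derivatives, so joint continuity in `(t, u)` passes to the
curvature. -/
theorem curvature_eq (hγ : IsClosedImmersion γ) (u : ℝ) :
    curvature γ u = inner ℝ (iteratedDeriv 2 γ u) (Complex.I * deriv γ u) / speed γ u ^ 3 := by
  have hs := (hγ.contDiff_speed.differentiable (by norm_num) u).hasDerivAt
  have h := hs.smul (hγ.hasDerivAt_tangent u)
  have h0 : (speed γ • tangent γ) = deriv γ := funext hγ.speed_smul_tangent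
  rw [h0] at h
  have h1 := h.unique (hγ.hasDerivAt_deriv u)
  have hpos := (hγ.speed_pos u).ne'
  have h2 : inner ℝ (tangent γ u) (normal γ u) = 0 := inner_I_mul_self _
  rw [eq_div_iff (by positivity), ← h1, ← hγ.speed_smul_normal, inner_add_left,
    real_inner_smul_right, real_inner_smul_right]
  simp only [real_inner_smul_left, h2, real_inner_self_eq_norm_sq, hγ.norm_normal]
  ring

theorem hasDerivAt_normal (hγ : IsClosedImmersion γ) (u : ℝ) :
    HasDerivAt (normal γ) (-(curvature γ u * speed γ u) • tangent γ u) u := by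
  have h := (hγ.hasDerivAt_tangent u).const_mul Complex.I
  refine h.congr_deriv ?_
  rw [normal, mul_smul_comm, ← mul_assoc, Complex.I_mul_I]
  simp

theorem continuous_curvature (hγ : IsClosedImmersion γ) : Continuous (curvature γ) := by
  rw [funext hγ.curvature_eq]
  have := hγ.continuous_iteratedDeriv_two
  have := hγ.continuous_deriv
  have := hγ.continuous_speed
  exact Continuous.div (by fun_prop) (by fun_prop) fun u => (pow_pos (hγ.speed_pos u) 3).ne'

theorem continuous_curvatureDeviation (hγ : IsClosedImmersion γ) :
    Continuous (curvatureDeviation γ) :=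
  hγ.continuous_curvature.sub continuous_const

theorem periodic_speed (hγ : IsClosedImmersion γ) : Function.Periodic (speed γ) 1 := fun u => by
  rw [speed, periodic_deriv hγ.periodic, speed]

theorem periodic_tangent (hγ : IsClosedImmersion γ) :
    Function.Periodic (tangent γ) 1 := fun u => by
  rw [tangent, arcDeriv, hγ.periodic_speed, periodic_deriv hγ.periodic, arcDeriv]

theorem periodic_curvature (hγ : IsClosedImmersion γ) :
    Function.Periodic (curvature γ) 1 := fun u => by
  simp only [curvature, curvatureVector, arcDeriv, normal, hγ.periodic_speed u,
    hγ.periodic_tangent u, periodic_deriv hγ.periodic_tangent u]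

theorem length_pos (hγ : IsClosedImmersion γ) : 0 < length γ :=
  intervalIntegral.intervalIntegral_pos_of_pos (hγ.continuous_speed.intervalIntegrable _ _)
    hγ.speed_pos one_pos

theorem area_eq (hγ : IsClosedImmersion γ) :
    area γ = -(1 / 2) * ∫ u in (0 : ℝ)..1, inner ℝ (γ u) (Complex.I * deriv γ u) := by
  rw [area, arcIntegral]
  congr 2
  funext u
  rw [← hγ.speed_smul_normal, real_inner_smul_right, mul_comm]

theorem integral_inner_const_I_mul_deriv (hγ : IsClosedImmersion γ) (c : ℂ) :
    ∫ u in (0 : ℝ)..1, inner ℝ c (Complex.I * deriv γ u) = 0 := by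
  have h := integral_inner_deriv_eq_neg (fun u => hasDerivAt_const u c)
    (fun u => (hγ.hasDerivAt u).const_mul Complex.I) continuous_const
    (continuous_const.mul hγ.continuous_deriv) (fun _ => rfl) (fun u => by rw [hγ.periodic u])
  simpa using h

/-- A crude isoperimetric inequality. -/
theorem area_le (hγ : IsClosedImmersion γ) : area γ ≤ length γ ^ 2 / 2 := by
  have c1 := hγ.continuous
  have c2 := hγ.continuous_deriv
  have c3 := hγ.continuous_speed
  -- The area integral is translation invariant, so the base point may be moved to `γ 0`, from which
  -- the curve stays within distance `L`.
  have h : area γ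
      = -(1 / 2) * ∫ u in (0 : ℝ)..1, inner ℝ (γ u - γ 0) (Complex.I * deriv γ u) := by
    simp only [inner_sub_left]
    rw [intervalIntegral.integral_sub (by apply Continuous.intervalIntegrable; fun_prop)
      (by apply Continuous.intervalIntegrable; fun_prop), hγ.integral_inner_const_I_mul_deriv,
      sub_zero, hγ.area_eq]
  have h2 : ∫ u in (0 : ℝ)..1, -inner ℝ (γ u - γ 0) (Complex.I * deriv γ u)
      ≤ ∫ u in (0 : ℝ)..1, length γ * speed γ u := by
    refine intervalIntegral.integral_mono_on zero_le_one
      (by apply Continuous.intervalIntegrable; fun_prop)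
      (by apply Continuous.intervalIntegrable; fun_prop) fun u hu => ?_
    refine (neg_le_abs _).trans ((abs_real_inner_le_norm _ _).trans ?_)
    rw [norm_mul, Complex.norm_I, one_mul]
    exact mul_le_mul_of_nonneg_right
      (norm_sub_le_integral_norm_deriv hγ.hasDerivAt c2 hu) (norm_nonneg _)
  rw [intervalIntegral.integral_neg, intervalIntegral.integral_const_mul] at h2
  change _ ≤ length γ * length γ at h2
  rw [h]
  linarith

/-- The map `ν + (1 / L) (∫ κ ds) γ` has arc-length derivative `-κ̃ τ`. -/
theorem hasDerivAt_normal_add (hγ : IsClosedImmersion γ) (u : ℝ) :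
    HasDerivAt (fun u => normal γ u + ((1 / length γ) * totalCurvature γ) • γ u)
      (-(curvatureDeviation γ u * speed γ u) • tangent γ u) u := by
  refine ((hγ.hasDerivAt_normal u).add ((hγ.hasDerivAt u).const_smul
    ((1 / length γ) * totalCurvature γ))).congr_deriv ?_
  rw [← hγ.speed_smul_tangent, curvatureDeviation, smul_smul, ← add_smul]
  congr 1
  ring

/-- With `w = ν + kγ`, `k` the mean curvature over the curve, `L I = ∫ ⟨w - w(0), ν⟩ ds`, and `w`
moves by at most `∫ |κ̃| ds` since `∂ₛ w = -κ̃ τ`. -/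
theorem abs_isoperimetricDeficit_le (hγ : IsClosedImmersion γ) :
    |isoperimetricDeficit γ| ≤ ∫ u in (0 : ℝ)..1, |curvatureDeviation γ u| * speed γ u := by
  have c1 := hγ.continuous
  have c2 := hγ.continuous_deriv
  have c3 := hγ.continuous_speed
  have c4 := hγ.continuous_normal
  have c5 := hγ.continuous_tangent
  have c6 := hγ.continuous_curvatureDeviation
  have hL := hγ.length_pos
  set k := (1 / length γ) * totalCurvature γ with hk
  set w : ℝ → ℂ := fun u => normal γ u + k • γ u with hw
  set m := ∫ u in (0 : ℝ)..1, |curvatureDeviation γ u| * speed γ u with hm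
  have cw : Continuous w := by fun_prop
  have h1 : ∀ u ∈ Set.Icc (0 : ℝ) 1, ‖w u - w 0‖ ≤ m := by
    intro u hu
    refine (norm_sub_le_integral_norm_deriv hγ.hasDerivAt_normal_add (by fun_prop) hu).trans_eq ?_
    congr 1
    funext v
    rw [norm_smul, hγ.norm_tangent, norm_neg, norm_mul, Real.norm_eq_abs,
      Real.norm_of_nonneg (hγ.speed_pos v).le, mul_one]
  -- The three terms integrate to `L`, `-2kA` and `0`; the last because `∫ ν ds = 0` on a closed
  -- curve.
  have h2 : length γ * isoperimetricDeficit γ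
      = ∫ u in (0 : ℝ)..1, inner ℝ (w u - w 0) (Complex.I * deriv γ u) := by
    have e : ∀ u, inner ℝ (w u - w 0) (Complex.I * deriv γ u)
        = speed γ u + k * inner ℝ (γ u) (Complex.I * deriv γ u)
          - inner ℝ (w 0) (Complex.I * deriv γ u) := by
      intro u
      rw [inner_sub_left, hw]
      simp only [inner_add_left, real_inner_smul_left]
      congr 2
      rw [← hγ.speed_smul_normal, real_inner_smul_right, real_inner_self_eq_norm_sq,
        hγ.norm_normal]
      ring
    simp only [e]
    rw [intervalIntegral.integral_sub (by apply Continuous.intervalIntegrable; fun_prop)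
      (by apply Continuous.intervalIntegrable; fun_prop), intervalIntegral.integral_add
      (by apply Continuous.intervalIntegrable; fun_prop)
      (by apply Continuous.intervalIntegrable; fun_prop), hγ.integral_inner_const_I_mul_deriv,
      intervalIntegral.integral_const_mul, isoperimetricDeficit_eq, hγ.area_eq, hk]
    change _ = length γ + _ - _
    field_simp
    ring
  have h3 : |length γ * isoperimetricDeficit γ| ≤ ∫ u in (0 : ℝ)..1, m * speed γ u := by
    rw [h2]
    refine (intervalIntegral.abs_integral_le_integral_abs zero_le_one).trans ?_
    refine intervalIntegral.integral_mono_on zero_le_one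
      (by apply Continuous.intervalIntegrable; fun_prop)
      (by apply Continuous.intervalIntegrable; fun_prop) fun u hu => ?_
    refine (abs_real_inner_le_norm _ _).trans ?_
    rw [norm_mul, Complex.norm_I, one_mul]
    exact mul_le_mul_of_nonneg_right (h1 u hu) (norm_nonneg _)
  rw [intervalIntegral.integral_const_mul, abs_mul, abs_of_pos hL] at h3
  change _ ≤ m * length γ at h3
  rw [mul_comm m] at h3
  exact le_of_mul_le_mul_left h3 hL

/-- Cauchy–Schwarz applied to the `L¹` bound on `κ̃`, obtained by expanding the square of `|κ̃|`
minus its mean `m / L`. -/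
theorem sq_isoperimetricDeficit_le (hγ : IsClosedImmersion γ) :
    isoperimetricDeficit γ ^ 2
      ≤ length γ * arcIntegral γ (fun u => curvatureDeviation γ u ^ 2) := by
  have c3 := hγ.continuous_speed
  have c6 := hγ.continuous_curvatureDeviation
  have hL := hγ.length_pos
  have h := hγ.abs_isoperimetricDeficit_le
  set m := ∫ u in (0 : ℝ)..1, |curvatureDeviation γ u| * speed γ u with hm
  have h1 : 0 ≤ ∫ u in (0 : ℝ)..1, (|curvatureDeviation γ u| - m / length γ) ^ 2 * speed γ u :=
    intervalIntegral.integral_nonneg zero_le_one fun u _ =>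
      mul_nonneg (sq_nonneg _) (hγ.speed_pos u).le
  have e : ∀ u, (|curvatureDeviation γ u| - m / length γ) ^ 2 * speed γ u
      = curvatureDeviation γ u ^ 2 * speed γ u
        - (2 * (m / length γ)) * (|curvatureDeviation γ u| * speed γ u)
        + (m / length γ) ^ 2 * speed γ u := by
    intro u
    rw [← sq_abs (curvatureDeviation γ u)]
    ring
  simp only [e] at h1
  rw [intervalIntegral.integral_add (by apply Continuous.intervalIntegrable; fun_prop)
      (by apply Continuous.intervalIntegrable; fun_prop), intervalIntegral.integral_sub
      (by apply Continuous.intervalIntegrable; fun_prop)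
      (by apply Continuous.intervalIntegrable; fun_prop), intervalIntegral.integral_const_mul,
      intervalIntegral.integral_const_mul] at h1
  change 0 ≤ arcIntegral γ (fun u => curvatureDeviation γ u ^ 2) - _ * m + _ * length γ at h1
  have h2 : m ^ 2 ≤ length γ * arcIntegral γ (fun u => curvatureDeviation γ u ^ 2) := by
    have h3 := mul_nonneg hL.le h1
    have h4 : length γ * (arcIntegral γ (fun u => curvatureDeviation γ u ^ 2)
        - (2 * (m / length γ)) * m + (m / length γ) ^ 2 * length γ)
        = length γ * arcIntegral γ (fun u => curvatureDeviation γ u ^ 2) - m ^ 2 := by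
      field_simp
      ring
    linarith
  refine le_trans ?_ h2
  rw [← sq_abs]
  exact pow_le_pow_left₀ (abs_nonneg _) h 2

theorem arcIntegral_sq_nonneg (hγ : IsClosedImmersion γ) (h : ℝ → ℝ) :
    0 ≤ arcIntegral γ (fun u => h u ^ 2) :=
  intervalIntegral.integral_nonneg zero_le_one fun u _ =>
      mul_nonneg (sq_nonneg _) (hγ.speed_pos u).le

theorem hasDerivAt_arcLength (hγ : IsClosedImmersion γ) (u : ℝ) :
    HasDerivAt (arcLength γ) (speed γ u) u :=
  intervalIntegral.integral_hasDerivAt_right (hγ.continuous_speed.intervalIntegrable _ _)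
    hγ.continuous_speed.stronglyMeasurable.stronglyMeasurableAtFilter
    hγ.continuous_speed.continuousAt

/-- A closed curve of constant curvature and rotation number `n ≥ 1` is an `n`-fold circle. -/
theorem isFoldCircle_of_curvatureDeviation_eq_zero (hγ : IsClosedImmersion γ) {n : ℕ}
    (hn : 1 ≤ n) (hrot : totalCurvature γ = 2 * Real.pi * n)
    (h : ∀ u, curvatureDeviation γ u = 0) : IsFoldCircle n γ := by
  have hL := hγ.length_pos
  have hn' : (0 : ℝ) < n := by exact_mod_cast hn
  have hk : 0 < (1 / length γ) * totalCurvature γ := by rw [hrot]; positivity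
  set k := (1 / length γ) * totalCurvature γ with hkdef
  have hκ : ∀ u, curvature γ u = k := fun u => by
    have := h u
    rw [curvatureDeviation] at this
    linarith
  -- For `κ̃ = 0` this constant, divided by `k`, is the centre of the circle; it remains to see that
  -- `ν` rotates at constant rate `k` in arc length.
  have h1 : ∀ u, normal γ u + k • γ u = normal γ 0 + k • γ 0 := by
    intro u
    refine is_const_of_deriv_eq_zero
      (fun v => (hγ.hasDerivAt_normal_add v).differentiableAt) (fun v => ?_) u 0
    rw [(hγ.hasDerivAt_normal_add v).deriv, h v]
    simp
  have h2 : ∀ u, HasDerivAt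
      (fun u => normal γ u * Complex.exp (-((k * arcLength γ u : ℝ) * Complex.I))) 0 u := by
    intro u
    have e := ((((hγ.hasDerivAt_arcLength u).const_mul k).ofReal_comp).mul_const
      Complex.I).neg.cexp
    refine ((hγ.hasDerivAt_normal u).mul e).congr_deriv ?_
    rw [hκ, normal]
    simp only [Complex.real_smul, Pi.neg_apply]
    push_cast
    linear_combination (-(k * speed γ u * tangent γ u *
      Complex.exp (-(k * arcLength γ u * Complex.I)))) * Complex.I_mul_I
  have h3 : ∀ u, normal γ u = normal γ 0 * Complex.exp ((k * arcLength γ u : ℝ) * Complex.I) := by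
    intro u
    have e := is_const_of_deriv_eq_zero (fun v => (h2 v).differentiableAt)
      (fun v => (h2 v).deriv) u 0
    have z : arcLength γ 0 = 0 := by simp [arcLength]
    simp only [z, mul_zero, Complex.ofReal_zero, zero_mul, neg_zero, Complex.exp_zero,
      mul_one] at e
    rw [← e, mul_assoc, ← Complex.exp_add]
    simp
  have hkC : (k : ℂ) ≠ 0 := by exact_mod_cast hk.ne'
  refine ⟨γ 0 + (k : ℂ)⁻¹ * normal γ 0, -((k : ℂ)⁻¹ * normal γ 0), ?_, fun u => ?_⟩
  · have : normal γ 0 ≠ 0 := norm_pos_iff.1 (by rw [hγ.norm_normal]; exact one_pos)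
    exact neg_ne_zero.2 (mul_ne_zero (inv_ne_zero hkC) this)
  · have e : 2 * Real.pi * n * (arcLength γ u / length γ) = k * arcLength γ u := by
      rw [hkdef, hrot]
      ring
    rw [e]
    have e1 := h1 u
    rw [h3 u] at e1
    simp only [Complex.real_smul] at e1
    field_simp
    linear_combination e1

theorem arcIntegral_sq_curvatureDeviation_pos (hγ : IsClosedImmersion γ) {n : ℕ}
    (hn : 1 ≤ n) (hrot : totalCurvature γ = 2 * Real.pi * n) (hc : ¬ IsFoldCircle n γ) :
    0 < arcIntegral γ (fun u => curvatureDeviation γ u ^ 2) := by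
  by_contra hneg
  refine hc (hγ.isFoldCircle_of_curvatureDeviation_eq_zero hn hrot ?_)
  have c3 := hγ.continuous_speed
  have c6 := hγ.continuous_curvatureDeviation
  by_contra! hne
  obtain ⟨u, hu⟩ := hne
  have hp : Function.Periodic (curvatureDeviation γ) 1 := fun v => by
    rw [curvatureDeviation, hγ.periodic_curvature, curvatureDeviation]
  -- The point `u` is moved into the period `[0, 1]` over which the integral is taken.
  have hu' : curvatureDeviation γ (Int.fract u) ≠ 0 := by
    have := hp.sub_int_mul_eq ⌊u⌋ (x := u)
    rw [mul_one] at this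
    rwa [Int.fract, this]
  have := hγ.speed_pos (Int.fract u)
  exact hneg (intervalIntegral.integral_pos one_pos (by fun_prop)
    (fun v _ => mul_nonneg (sq_nonneg _) (hγ.speed_pos v).le)
    ⟨Int.fract u, ⟨Int.fract_nonneg u, (Int.fract_lt_one u).le⟩, by positivity⟩)

/-- The total curvature of a closed curve is an integral multiple of `2π`. -/
theorem exists_totalCurvature_eq (hγ : IsClosedImmersion γ) :
    ∃ m : ℤ, totalCurvature γ = m * (2 * Real.pi) := by
  have cκ : Continuous fun u => curvature γ u * speed γ u :=
    hγ.continuous_curvature.mul hγ.continuous_speed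
  set ψ : ℝ → ℝ := fun u => ∫ v in (0 : ℝ)..u, curvature γ v * speed γ v with hψ
  have h1 : ∀ u, HasDerivAt ψ (curvature γ u * speed γ u) u := fun u =>
    intervalIntegral.integral_hasDerivAt_right (cκ.intervalIntegrable _ _)
      cκ.stronglyMeasurable.stronglyMeasurableAtFilter cκ.continuousAt
  -- `ψ` is the turning angle, so `τ exp(-iψ)` is constant; periodicity of `τ` then forces
  -- `exp(iψ(1)) = 1`.
  have h2 : ∀ u, HasDerivAt
      (fun u => tangent γ u * Complex.exp (-((ψ u : ℝ) * Complex.I))) 0 u := by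
    intro u
    have e := (((h1 u).ofReal_comp).mul_const Complex.I).neg.cexp
    refine ((hγ.hasDerivAt_tangent u).mul e).congr_deriv ?_
    rw [normal]
    simp only [Complex.real_smul, Pi.neg_apply]
    push_cast
    ring
  have e := is_const_of_deriv_eq_zero (fun v => (h2 v).differentiableAt)
    (fun v => (h2 v).deriv) 1 0
  have z : ψ 0 = 0 := by simp [hψ]
  have p := hγ.periodic_tangent 0
  rw [zero_add] at p
  have ht : tangent γ 0 ≠ 0 := norm_pos_iff.1 (by rw [hγ.norm_tangent]; exact one_pos)
  simp only [z, p, Complex.ofReal_zero, zero_mul, neg_zero, Complex.exp_zero] at e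
  have e1 := mul_left_cancel₀ ht e
  rw [Complex.exp_neg, inv_eq_one, Complex.exp_eq_one_iff] at e1
  obtain ⟨m, hm⟩ := e1
  refine ⟨m, ?_⟩
  change ψ 1 = _
  rw [← mul_assoc] at hm
  have := mul_right_cancel₀ Complex.I_ne_zero hm
  exact_mod_cast this

end IsClosedImmersion

/-! ### First variation of length and area -/

/-- A time-dependent family of closed immersed curves, continuous together with its first two
derivatives in the curve parameter. -/
structure IsContinuousFamily (φ : ℝ → ℝ → ℂ) : Prop where
  immersion : ∀ t, IsClosedImmersion (φ t)
  continuous : ∀ k ≤ 2, Continuous fun p : ℝ × ℝ => iteratedDeriv k (φ p.1) p.2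

/-- Convexity of the length functional. -/
theorem IsClosedImmersion.length_sub_length_ge {γ η : ℝ → ℂ} (hγ : IsClosedImmersion γ)
    (hη : IsClosedImmersion η) :
    -∫ u in (0 : ℝ)..1, inner ℝ ((curvature η u * speed η u) • normal η u) (γ u - η u)
      ≤ length γ - length η := by
  have c1 := hγ.continuous_deriv
  have c2 := hη.continuous_deriv
  have c3 := hη.continuous_tangent
  have c4 := hη.continuous_curvature
  have c5 := hη.continuous_speed
  have c6 := hη.continuous_normal
  have c7 := hγ.continuous_speed
  -- After integration by parts the claim is the integral of the pointwise inequality `⟨τ_η, γ' -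
  -- η'⟩ ≤ |γ'| - |η'|`.
  have h := integral_inner_deriv_eq_neg hη.hasDerivAt_tangent
    (fun u => (hγ.hasDerivAt u).sub (hη.hasDerivAt u)) (by fun_prop) (by fun_prop)
    hη.periodic_tangent (fun u => by simp only [Pi.sub_apply, hγ.periodic u, hη.periodic u])
  simp only [Pi.sub_apply] at h
  rw [← h, length, length, ← intervalIntegral.integral_sub (c7.intervalIntegrable _ _)
    (c5.intervalIntegrable _ _)]
  refine intervalIntegral.integral_mono_on zero_le_one
    (by apply Continuous.intervalIntegrable; fun_prop)
    (by apply Continuous.intervalIntegrable; fun_prop) fun u _ => ?_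
  rw [inner_sub_right]
  refine sub_le_sub ?_ (le_of_eq ?_)
  · refine (real_inner_le_norm _ _).trans_eq ?_
    rw [hη.norm_tangent, one_mul, speed]
  · rw [← hη.speed_smul_tangent, real_inner_smul_right, real_inner_self_eq_norm_sq,
      hη.norm_tangent]
    ring

/-- Area is a quadratic form whose bilinear form `B` is symmetric by integration by parts, so the
difference is `B(γ - η, γ + η)`. No derivative falls on `γ - η`, which matters because only `γ - η`
has a controlled difference quotient in time. -/
theorem IsClosedImmersion.area_sub_area {γ η : ℝ → ℂ} (hγ : IsClosedImmersion γ)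
    (hη : IsClosedImmersion η) :
    area γ - area η = -(1 / 2) * (∫ u in (0 : ℝ)..1, inner ℝ (Complex.I * deriv γ u) (γ u - η u))
      - (1 / 2) * ∫ u in (0 : ℝ)..1, inner ℝ (Complex.I * deriv η u) (γ u - η u) := by
  have c1 := hγ.continuous_deriv
  have c2 := hη.continuous_deriv
  have c3 := hγ.continuous
  have c4 := hη.continuous
  have h := integral_inner_deriv_eq_neg (fun u => (hη.hasDerivAt u).const_mul Complex.I)
    (fun u => (hγ.hasDerivAt u).sub (hη.hasDerivAt u)) (by fun_prop) (by fun_prop)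
    (fun u => by rw [hη.periodic u])
    (fun u => by simp only [Pi.sub_apply, hγ.periodic u, hη.periodic u])
  simp only [Pi.sub_apply] at h
  have e : ∀ u, inner ℝ (Complex.I * η u) (deriv γ u - deriv η u)
      = inner ℝ (η u) (Complex.I * deriv η u) - inner ℝ (η u) (Complex.I * deriv γ u) := by
    intro u
    rw [inner_I_mul_right, inner_I_mul_right, inner_sub_right]
    ring
  have e2 : ∀ u, inner ℝ (Complex.I * deriv γ u) (γ u - η u)
      = inner ℝ (γ u) (Complex.I * deriv γ u) - inner ℝ (η u) (Complex.I * deriv γ u) := by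
    intro u
    rw [inner_sub_right, real_inner_comm, real_inner_comm (Complex.I * deriv γ u) (η u)]
  simp only [e] at h
  simp only [e2]
  rw [intervalIntegral.integral_sub (by apply Continuous.intervalIntegrable; fun_prop)
    (by apply Continuous.intervalIntegrable; fun_prop)] at h ⊢
  rw [hγ.area_eq, hη.area_eq]
  linarith

/-- Dominated convergence: on the compact set `[0, t + 1] × [0, 1]` the mean value inequality bounds
the difference quotients by the supremum of the velocity. The weight may depend on the moving time
`s`. -/
theorem tendsto_integral_inner_slope {x w ψ : ℝ → ℝ → ℂ}
    (hx : ∀ t, 0 ≤ t → ∀ u, HasDerivWithinAt (fun s => x s u) (w t u) (Set.Ici 0) t)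
    (cx : ∀ t, Continuous (x t)) (cw : Continuous fun p : ℝ × ℝ => w p.1 p.2)
    (cψ : Continuous fun p : ℝ × ℝ => ψ p.1 p.2) {t : ℝ} (ht : 0 ≤ t) :
    Tendsto (fun s => ∫ u in (0 : ℝ)..1, inner ℝ (ψ s u) (slope (fun r => x r u) t s))
      (𝓝[Set.Ici 0 \ {t}] t) (𝓝 (∫ u in (0 : ℝ)..1, inner ℝ (ψ t u) (w t u))) := by
  have hK : IsCompact (Set.Icc (0 : ℝ) (t + 1) ×ˢ Set.Icc (0 : ℝ) 1) :=
    isCompact_Icc.prod isCompact_Icc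
  obtain ⟨C, hC⟩ := hK.exists_bound_of_continuousOn cw.continuousOn
  obtain ⟨D, hD⟩ := hK.exists_bound_of_continuousOn cψ.continuousOn
  have hev : ∀ᶠ s in 𝓝[Set.Ici 0 \ {t}] t, s ∈ Set.Icc (0 : ℝ) (t + 1) ∧ s ≠ t := by
    have h1 : ∀ᶠ s in 𝓝[Set.Ici 0 \ {t}] t, s < t + 1 :=
      nhdsWithin_le_nhds (Iio_mem_nhds (by linarith))
    filter_upwards [h1, self_mem_nhdsWithin] with s h1 h2
    exact ⟨⟨h2.1, h1.le⟩, h2.2⟩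
  refine intervalIntegral.tendsto_integral_filter_of_dominated_convergence (fun _ => D * C)
    ?_ ?_ (by simp) ?_
  · refine Eventually.of_forall fun s => Continuous.aestronglyMeasurable ?_
    have c1 := cx s
    have c2 := cx t
    have c3 : Continuous (ψ s) := cψ.comp (Continuous.prodMk_right s)
    simp only [slope, vsub_eq_sub]
    fun_prop
  · filter_upwards [hev] with s hs
    refine Eventually.of_forall fun u hu => ?_
    rw [Set.uIoc_of_le zero_le_one] at hu
    have hu' : u ∈ Set.Icc (0 : ℝ) 1 := ⟨hu.1.le, hu.2⟩
    have h1 : ‖x s u - x t u‖ ≤ C * ‖s - t‖ :=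
      (convex_Icc (0 : ℝ) (t + 1)).norm_image_sub_le_of_norm_hasDerivWithin_le
        (f := fun r => x r u) (f' := fun r => w r u)
        (fun r hr => (hx r hr.1 u).mono Set.Icc_subset_Ici_self)
        (fun r hr => hC (r, u) ⟨hr, hu'⟩) ⟨ht, by linarith⟩ hs.1
    have h2 : ‖slope (fun r => x r u) t s‖ ≤ C := by
      rw [slope_def_module, norm_smul, norm_inv, inv_mul_le_iff₀ (norm_pos_iff.2 (sub_ne_zero.2 hs.2)),
        mul_comm]
      exact h1
    have h3 := hD (s, u) ⟨hs.1, hu'⟩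
    refine (norm_inner_le_norm _ _).trans ?_
    exact mul_le_mul h3 h2 (norm_nonneg _) ((norm_nonneg _).trans h3)
  · refine Eventually.of_forall fun u _ => Tendsto.inner ?_ ?_
    · exact ((cψ.comp (Continuous.prodMk_left u)).tendsto t).mono_left nhdsWithin_le_nhds
    · exact hasDerivWithinAt_iff_tendsto_slope.1 (hx t ht u)

theorem integral_inner_slope (x : ℝ → ℝ → ℂ) (ψ : ℝ → ℂ) (t s : ℝ) :
    ∫ u in (0 : ℝ)..1, inner ℝ (ψ u) (slope (fun r => x r u) t s)
      = (s - t)⁻¹ * ∫ u in (0 : ℝ)..1, inner ℝ (ψ u) (x s u - x t u) := by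
  simp only [slope_def_module, real_inner_smul_right, intervalIntegral.integral_const_mul]

namespace IsContinuousFamily

variable {φ w : ℝ → ℝ → ℂ}

theorem continuous_uncurry (h : IsContinuousFamily φ) :
    Continuous fun p : ℝ × ℝ => φ p.1 p.2 := by
  simpa using h.continuous 0 (by norm_num)

theorem continuous_deriv (h : IsContinuousFamily φ) :
    Continuous fun p : ℝ × ℝ => deriv (φ p.1) p.2 := by
  simpa using h.continuous 1 (by norm_num)

theorem continuous_speed (h : IsContinuousFamily φ) :
    Continuous fun p : ℝ × ℝ => speed (φ p.1) p.2 :=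
  h.continuous_deriv.norm

theorem continuous_tangent (h : IsContinuousFamily φ) :
    Continuous fun p : ℝ × ℝ => tangent (φ p.1) p.2 :=
  (h.continuous_speed.inv₀ fun p => ((h.immersion p.1).speed_pos p.2).ne').smul
    h.continuous_deriv

theorem continuous_normal (h : IsContinuousFamily φ) :
    Continuous fun p : ℝ × ℝ => normal (φ p.1) p.2 :=
  continuous_const.mul h.continuous_tangent

theorem continuous_curvature (h : IsContinuousFamily φ) :
    Continuous fun p : ℝ × ℝ => curvature (φ p.1) p.2 := by
  simp only [fun p : ℝ × ℝ => (h.immersion p.1).curvature_eq p.2]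
  have := h.continuous 2 le_rfl
  have := h.continuous_deriv
  have := h.continuous_speed
  exact Continuous.div (by fun_prop) (by fun_prop)
    fun p => (pow_pos ((h.immersion p.1).speed_pos p.2) 3).ne'

theorem continuous_arcIntegral (h : IsContinuousFamily φ) {k : ℝ → ℝ → ℝ}
    (hk : Continuous fun p : ℝ × ℝ => k p.1 p.2) :
    Continuous fun t => arcIntegral (φ t) (k t) :=
  intervalIntegral.continuous_parametric_intervalIntegral_of_continuous'
    (f := fun t u => k t u * speed (φ t) u) (hk.mul h.continuous_speed) 0 1

theorem continuous_length (h : IsContinuousFamily φ) : Continuous fun t => length (φ t) :=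
  intervalIntegral.continuous_parametric_intervalIntegral_of_continuous'
    (f := fun t u => speed (φ t) u) h.continuous_speed 0 1

theorem continuous_totalCurvature (h : IsContinuousFamily φ) :
    Continuous fun t => totalCurvature (φ t) :=
  h.continuous_arcIntegral h.continuous_curvature

theorem continuous_area (h : IsContinuousFamily φ) : Continuous fun t => area (φ t) :=
  continuous_const.mul (h.continuous_arcIntegral (h.continuous_uncurry.inner h.continuous_normal))

theorem continuous_curvatureDeviation (h : IsContinuousFamily φ) :
    Continuous fun p : ℝ × ℝ => curvatureDeviation (φ p.1) p.2 := by
  have c1 := h.continuous_curvature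
  have c2 : Continuous fun t => 1 / length (φ t) :=
    continuous_const.div h.continuous_length fun t => (h.immersion t).length_pos.ne'
  have c3 := h.continuous_totalCurvature
  exact c1.sub ((c2.comp continuous_fst).mul (c3.comp continuous_fst))

theorem continuous_forcing (h : IsContinuousFamily φ) {F : FlowType}
    (hF : ∀ t, ForcingDefined F (φ t)) : Continuous fun t => forcing F (φ t) := by
  have c1 := h.continuous_length
  have c2 := h.continuous_totalCurvature
  have c3 := h.continuous_area
  have c4 := h.continuous_arcIntegral (k := fun t u => curvatureDeviation (φ t) u ^ 2)
    (h.continuous_curvatureDeviation.pow 2)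
  cases F with
  | AP => exact continuous_const
  | LP => exact (c1.mul (c2.inv₀ hF)).mul c4
  | JP => exact ((c1.pow 2).div (continuous_const.mul c3)
      fun t => mul_ne_zero two_ne_zero (hF t)).sub c2

/-- A continuous integer-valued function on the line is constant. -/
theorem totalCurvature_eq (h : IsContinuousFamily φ) (t s : ℝ) :
    totalCurvature (φ t) = totalCurvature (φ s) := by
  choose m hm using fun t => (h.immersion t).exists_totalCurvature_eq
  have hc : Continuous fun t => (m t : ℝ) := by
    have e : (fun t => (m t : ℝ)) = fun t => totalCurvature (φ t) / (2 * Real.pi) := by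
      funext t
      rw [hm t, mul_div_cancel_right₀ _ Real.two_pi_pos.ne']
    rw [e]
    exact h.continuous_totalCurvature.div_const _
  have hc' : Continuous m := Int.isClosedEmbedding_coe_real.isInducing.continuous_iff.2 hc
  rw [hm t, hm s, PreconnectedSpace.constant inferInstance hc' (x := t) (y := s)]

/-- The convexity inequality, used once in each direction between times `s` and `t`, traps the
increment of length between pairings of the displacement with the curvature density at `t` and at
`s`; divided by `s - t`, both have the same limit. -/
theorem hasDerivWithinAt_length (h : IsContinuousFamily φ)
    (hφ : ∀ t, 0 ≤ t → ∀ u, HasDerivWithinAt (fun s => φ s u) (w t u) (Set.Ici 0) t)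
    (cw : Continuous fun p : ℝ × ℝ => w p.1 p.2) {t : ℝ} (ht : 0 ≤ t) :
    HasDerivWithinAt (fun s => length (φ s))
      (-∫ u in (0 : ℝ)..1,
        inner ℝ ((curvature (φ t) u * speed (φ t) u) • normal (φ t) u) (w t u))
      (Set.Ici 0) t := by
  set D : ℝ → ℝ → ℂ := fun s u => (curvature (φ s) u * speed (φ s) u) • normal (φ s) u
  have cD : Continuous fun p : ℝ × ℝ => D p.1 p.2 :=
    (h.continuous_curvature.mul h.continuous_speed).smul h.continuous_normal
  have cDt : Continuous fun p : ℝ × ℝ => D t p.2 :=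
    Continuous.comp (g := fun p : ℝ × ℝ => D p.1 p.2) (f := fun p : ℝ × ℝ => ((t, p.2) : ℝ × ℝ))
      cD (by fun_prop)
  have hP := tendsto_integral_inner_slope hφ (fun s => (h.immersion s).continuous) cw cD ht
  have hQ := tendsto_integral_inner_slope (ψ := fun _ => D t) hφ
    (fun s => (h.immersion s).continuous) cw cDt ht
  rw [hasDerivWithinAt_iff_tendsto_slope]
  set P := fun s => ∫ u in (0 : ℝ)..1, inner ℝ (D s u) (slope (fun r => φ r u) t s) with hPdef
  set Q := fun s => ∫ u in (0 : ℝ)..1, inner ℝ (D t u) (slope (fun r => φ r u) t s) with hQdef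
  -- Here `slope + Q` is bounded in absolute value by `|P - Q|`, and `P`, `Q` share a limit.
  have hR : Tendsto (fun s => slope (fun s => length (φ s)) t s + Q s)
      (𝓝[Set.Ici 0 \ {t}] t) (𝓝 0) := by
    have hPQ := (hP.sub hQ).abs
    rw [sub_self, abs_zero] at hPQ
    refine squeeze_zero_norm (fun s => ?_) hPQ
    have h1 := (h.immersion s).length_sub_length_ge (h.immersion t)
    have h2 := (h.immersion t).length_sub_length_ge (h.immersion s)
    have h3 : ∫ u in (0 : ℝ)..1, inner ℝ (D s u) (φ t u - φ s u)
        = -∫ u in (0 : ℝ)..1, inner ℝ (D s u) (φ s u - φ t u) := by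
      rw [← intervalIntegral.integral_neg]
      congr 1
      funext u
      rw [← inner_neg_right, neg_sub]
    change -(∫ u in (0 : ℝ)..1, inner ℝ (D s u) (φ t u - φ s u)) ≤ _ at h2
    change -(∫ u in (0 : ℝ)..1, inner ℝ (D t u) (φ s u - φ t u)) ≤ _ at h1
    rw [h3] at h2
    rw [hPdef, hQdef]
    simp only [integral_inner_slope]
    rw [slope_def_module, smul_eq_mul, ← mul_add, ← mul_sub, Real.norm_eq_abs, abs_mul, abs_mul]
    refine mul_le_mul_of_nonneg_left ?_ (abs_nonneg _)
    rw [abs_of_nonneg (by linarith), abs_sub_comm, abs_of_nonneg (by linarith)]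
    linarith
  have := hR.sub hQ
  rw [zero_sub] at this
  exact this.congr fun s => add_sub_cancel_right _ _

theorem hasDerivWithinAt_area (h : IsContinuousFamily φ)
    (hφ : ∀ t, 0 ≤ t → ∀ u, HasDerivWithinAt (fun s => φ s u) (w t u) (Set.Ici 0) t)
    (cw : Continuous fun p : ℝ × ℝ => w p.1 p.2) {t : ℝ} (ht : 0 ≤ t) :
    HasDerivWithinAt (fun s => area (φ s))
      (-∫ u in (0 : ℝ)..1, inner ℝ (Complex.I * deriv (φ t) u) (w t u)) (Set.Ici 0) t := by
  have cD : Continuous fun p : ℝ × ℝ => Complex.I * deriv (φ p.1) p.2 :=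
    continuous_const.mul h.continuous_deriv
  have cDt : Continuous fun p : ℝ × ℝ => Complex.I * deriv (φ t) p.2 :=
    cD.comp (continuous_const.prodMk continuous_snd)
  have hP := tendsto_integral_inner_slope (ψ := fun s u => Complex.I * deriv (φ s) u) hφ
    (fun s => (h.immersion s).continuous) cw cD ht
  have hQ := tendsto_integral_inner_slope (ψ := fun _ u => Complex.I * deriv (φ t) u) hφ
    (fun s => (h.immersion s).continuous) cw cDt ht
  rw [hasDerivWithinAt_iff_tendsto_slope]
  have hR := (hP.const_mul (-(1 / 2))).sub (hQ.const_mul (1 / 2))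
  convert hR using 1
  · funext s
    rw [slope_def_module, (h.immersion s).area_sub_area (h.immersion t), integral_inner_slope,
      integral_inner_slope, smul_eq_mul]
    ring
  · congr 1
    ring

end IsContinuousFamily

/-! ### First variation in the direction of the flow -/

/-- The velocity `(κ̃ - g / L) ν` of the flow. -/
noncomputable def velocity (F : FlowType) (γ : ℝ → ℂ) (u : ℝ) : ℂ :=
  (curvatureDeviation γ u - forcing F γ / length γ) • normal γ u

theorem IsClosedImmersion.integral_curvatureDeviation {γ : ℝ → ℂ} (hγ : IsClosedImmersion γ) :
    ∫ u in (0 : ℝ)..1, curvatureDeviation γ u * speed γ u = 0 := by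
  have c1 := hγ.continuous_speed
  have c2 := hγ.continuous_curvature
  have hL := hγ.length_pos.ne'
  simp only [curvatureDeviation, sub_mul]
  rw [intervalIntegral.integral_sub (by apply Continuous.intervalIntegrable; fun_prop)
    (by apply Continuous.intervalIntegrable; fun_prop), intervalIntegral.integral_const_mul]
  change totalCurvature γ - 1 / length γ * totalCurvature γ * length γ = 0
  field_simp
  ring

theorem IsClosedImmersion.integral_inner_curvature_velocity {γ : ℝ → ℂ}
    (hγ : IsClosedImmersion γ) (F : FlowType) :
    ∫ u in (0 : ℝ)..1, inner ℝ ((curvature γ u * speed γ u) • normal γ u) (velocity F γ u)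
      = arcIntegral γ (fun u => curvatureDeviation γ u ^ 2)
        - totalCurvature γ * forcing F γ / length γ := by
  have c1 := hγ.continuous_speed
  have c2 := hγ.continuous_curvature
  have c3 := hγ.continuous_curvatureDeviation
  -- Writing `κ = κ̃ + k` with `k` the mean gives `κ κ̃ = κ̃² + k κ̃`, and the last term integrates
  -- to zero.
  have e : ∀ u, inner ℝ ((curvature γ u * speed γ u) • normal γ u) (velocity F γ u)
      = curvatureDeviation γ u ^ 2 * speed γ u
        + ((1 / length γ) * totalCurvature γ) * (curvatureDeviation γ u * speed γ u)
        - forcing F γ / length γ * (curvature γ u * speed γ u) := by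
    intro u
    rw [velocity, real_inner_smul_left, real_inner_smul_right, real_inner_self_eq_norm_sq,
      hγ.norm_normal, curvatureDeviation]
    ring
  simp only [e]
  rw [intervalIntegral.integral_sub (by apply Continuous.intervalIntegrable; fun_prop)
    (by apply Continuous.intervalIntegrable; fun_prop), intervalIntegral.integral_add
    (by apply Continuous.intervalIntegrable; fun_prop)
    (by apply Continuous.intervalIntegrable; fun_prop), intervalIntegral.integral_const_mul,
    intervalIntegral.integral_const_mul, hγ.integral_curvatureDeviation]
  change arcIntegral γ (fun u => curvatureDeviation γ u ^ 2) + _ - _ * totalCurvature γ = _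
  ring

theorem IsClosedImmersion.integral_inner_deriv_velocity {γ : ℝ → ℂ}
    (hγ : IsClosedImmersion γ) (F : FlowType) :
    ∫ u in (0 : ℝ)..1, inner ℝ (Complex.I * deriv γ u) (velocity F γ u) = -forcing F γ := by
  have c1 := hγ.continuous_speed
  have c3 := hγ.continuous_curvatureDeviation
  have hL := hγ.length_pos.ne'
  have e : ∀ u, inner ℝ (Complex.I * deriv γ u) (velocity F γ u)
      = curvatureDeviation γ u * speed γ u - forcing F γ / length γ * speed γ u := by
    intro u
    rw [velocity, ← hγ.speed_smul_normal, real_inner_smul_left, real_inner_smul_right,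
      real_inner_self_eq_norm_sq, hγ.norm_normal]
    ring
  simp only [e]
  rw [intervalIntegral.integral_sub (by apply Continuous.intervalIntegrable; fun_prop)
    (by apply Continuous.intervalIntegrable; fun_prop), intervalIntegral.integral_const_mul,
    hγ.integral_curvatureDeviation]
  change 0 - forcing F γ / length γ * length γ = _
  field_simp
  ring

/-! ### Differential inequalities on a half-line -/

theorem le_add_mul_of_hasDerivWithinAt_le {y y' : ℝ → ℝ} {c a : ℝ} (ha : 0 ≤ a)
    (hy : ∀ t, 0 ≤ t → HasDerivWithinAt y (y' t) (Set.Ici 0) t) (hc : ∀ t, a ≤ t → y' t ≤ c)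
    {t : ℝ} (ht : a ≤ t) : y t ≤ y a + c * (t - a) := by
  have h := (convex_Ici a).image_sub_le_mul_sub_of_deriv_le (f := y) (C := c)
    (fun s hs => (hy s (ha.trans hs)).continuousWithinAt.mono (Set.Ici_subset_Ici.2 ha))
    (fun s hs => ?_) (fun s hs => ?_) a Set.self_mem_Ici t ht ht
  · linarith
  all_goals
    rw [interior_Ici, Set.mem_Ioi] at hs
    have hd := (hy s (ha.trans hs.le)).hasDerivAt (Ici_mem_nhds (ha.trans_lt hs))
  · exact hd.differentiableAt.differentiableWithinAt
  · rw [hd.deriv]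
    exact hc s hs.le

theorem exists_neg_of_le_sub_mul {y : ℝ → ℝ} {a c b : ℝ} (hc : 0 < c)
    (h : ∀ t, a ≤ t → y t ≤ b - c * (t - a)) : ∃ t, a ≤ t ∧ y t < 0 := by
  refine ⟨a + (|b| + 1) / c, by have : 0 ≤ (|b| + 1) / c := by positivity
                                linarith, ?_⟩
  refine (h _ (by have : 0 ≤ (|b| + 1) / c := by positivity
                  linarith)).trans_lt ?_
  have : c * (a + (|b| + 1) / c - a) = |b| + 1 := by
    field_simp
    ring
  rw [this]
  linarith [le_abs_self b]

/-- A positive function on `[0, ∞)` has no derivative bounded above by a negative constant. -/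
theorem false_of_pos_of_hasDerivWithinAt_le_neg {y y' : ℝ → ℝ} {c a : ℝ} (ha : 0 ≤ a)
    (hc : 0 < c) (hy : ∀ t, 0 ≤ t → HasDerivWithinAt y (y' t) (Set.Ici 0) t)
    (hpos : ∀ t, 0 ≤ t → 0 < y t) (hle : ∀ t, a ≤ t → y' t ≤ -c) : False := by
  obtain ⟨t, ht, h⟩ := exists_neg_of_le_sub_mul (y := y) (a := a) (b := y a) hc fun t ht => by
    linarith [le_add_mul_of_hasDerivWithinAt_le ha hy hle ht]
  exact (hpos t (ha.trans ht)).not_gt h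

theorem exists_pos_lt_of_hasDerivWithinAt_neg {y : ℝ → ℝ} {y' : ℝ} (hy' : y' < 0)
    (hy : HasDerivWithinAt y y' (Set.Ici 0) 0) : ∃ t, 0 < t ∧ y t < y 0 := by
  have h := hasDerivWithinAt_iff_tendsto_slope.1 hy
  rw [Set.Ici_sdiff_left] at h
  obtain ⟨t, h1, h2⟩ := ((h.eventually_lt_const hy').and self_mem_nhdsWithin).exists
  refine ⟨t, h2, ?_⟩
  rw [slope_def_field, sub_zero] at h1
  have := (div_neg_iff.1 h1).resolve_left fun h => (lt_asymm (Set.mem_Ioi.1 h2) h.2)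
  linarith [this.1]

/-! ### Scalar evolution and the three contradictions -/

/-- The evolution of length `L`, area `A`, deficit `I` and `K = ∫ κ̃² ds` along a flow with total
curvature `c`. -/
structure IsEvolution (c : ℝ) (L A I K g : ℝ → ℝ) : Prop where
  length_pos : ∀ t, 0 ≤ t → 0 < L t
  energy_nonneg : ∀ t, 0 ≤ t → 0 ≤ K t
  deficit_eq : ∀ t, I t = 1 - 2 * c * A t / L t ^ 2
  sq_deficit_le : ∀ t, 0 ≤ t → I t ^ 2 ≤ L t * K t
  area_le : ∀ t, 0 ≤ t → A t ≤ L t ^ 2 / 2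
  length_deriv : ∀ t, 0 ≤ t → HasDerivWithinAt L (-(K t - c * g t / L t)) (Set.Ici 0) t
  area_deriv : ∀ t, 0 ≤ t → HasDerivWithinAt A (g t) (Set.Ici 0) t

namespace IsEvolution

variable {c : ℝ} {L A I K g : ℝ → ℝ}

theorem deficit_deriv (h : IsEvolution c L A I K g) (t : ℝ) (ht : 0 ≤ t) :
    HasDerivWithinAt I (-(2 * c / L t ^ 2) * (g t * I t + 2 * A t / L t * K t)) (Set.Ici 0) t := by
  have hL := (h.length_pos t ht).ne'
  have := ((((h.area_deriv t ht).const_mul (2 * c)).div ((h.length_deriv t ht).pow 2)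
    (pow_ne_zero 2 hL)).const_sub 1)
  rw [funext h.deficit_eq]
  refine this.congr_deriv ?_
  simp only [Pi.pow_apply]
  field_simp
  ring

theorem length_sq_deriv (h : IsEvolution c L A I K g) (t : ℝ) (ht : 0 ≤ t) :
    HasDerivWithinAt (fun s => L s ^ 2) (-(2 * (L t * K t)) + 2 * c * g t) (Set.Ici 0) t := by
  have hL := (h.length_pos t ht).ne'
  refine ((h.length_deriv t ht).pow 2).congr_deriv ?_
  field_simp
  ring

theorem antitone_deficit (h : IsEvolution c L A I K g) (hc : 0 < c)
    (hg : ∀ t, 0 ≤ t → 0 ≤ g t * I t + 2 * A t / L t * K t) {a t : ℝ} (ha : 0 ≤ a) (ht : a ≤ t) :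
    I t ≤ I a := by
  have := le_add_mul_of_hasDerivWithinAt_le (c := 0) ha h.deficit_deriv (fun s hs => ?_) ht
  · linarith
  · have := h.length_pos s (ha.trans hs)
    rw [neg_mul]
    exact neg_nonpos.2 (mul_nonneg (by positivity) (hg s (ha.trans hs)))

/-- The derivative of `I` at time `0` is strictly negative, so `I` is negative at some `a > 0`, and
monotonicity keeps it below `I a = -δ`. -/
theorem exists_deficit_le (h : IsEvolution c L A I K g) (hc : 0 < c)
    (hg : ∀ t, 0 ≤ t → 0 ≤ g t * I t + 2 * A t / L t * K t) (hA : 0 < A 0) (hI : I 0 = 0)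
    (hK : 0 < K 0) : ∃ a δ, 0 ≤ a ∧ 0 < δ ∧ ∀ t, a ≤ t → I t ≤ -δ := by
  have hneg : -(2 * c / L 0 ^ 2) * (g 0 * I 0 + 2 * A 0 / L 0 * K 0) < 0 := by
    have := h.length_pos 0 le_rfl
    rw [hI, mul_zero, zero_add, neg_mul]
    exact neg_neg_of_pos (by positivity)
  obtain ⟨a, ha, h1⟩ := exists_pos_lt_of_hasDerivWithinAt_neg hneg (h.deficit_deriv 0 le_rfl)
  rw [hI] at h1
  exact ⟨a, -I a, ha.le, by linarith, fun t ht => by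
    linarith [h.antitone_deficit hc hg ha.le ht]⟩

theorem energy_ge (h : IsEvolution c L A I K g) {t δ : ℝ} (ht : 0 ≤ t) (hδ : 0 < δ)
    (hI : I t ≤ -δ) : δ ^ 2 ≤ L t * K t :=
  le_trans (by nlinarith) (h.sq_deficit_le t ht)

/-- Area stays at its positive initial value, and `(L²)' = -2 L K ≤ -2δ²` eventually. -/
theorem false_of_areaPreserving (h : IsEvolution c L A I K g) (hc : 0 < c)
    (hg : ∀ t, g t = 0) (hA : 0 < A 0) (hI : I 0 = 0) (hK : 0 < K 0) : False := by
  have hA' : ∀ t, 0 ≤ t → 0 < A t := fun t ht => by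
    have := le_add_mul_of_hasDerivWithinAt_le (y := fun t => -A t) (c := 0) le_rfl
      (fun s hs => (h.area_deriv s hs).neg) (fun s _ => by rw [hg, neg_zero]) ht
    linarith
  obtain ⟨a, δ, ha, hδ, hle⟩ := h.exists_deficit_le hc (fun t ht => by
    have h1 := h.length_pos t ht
    have h2 := h.energy_nonneg t ht
    have h3 := hA' t ht
    rw [hg, zero_mul, zero_add]
    positivity) hA hI hK
  refine false_of_pos_of_hasDerivWithinAt_le_neg (c := 2 * δ ^ 2) ha (by positivity)
    h.length_sq_deriv (fun t ht => pow_pos (h.length_pos t ht) 2) fun t ht => ?_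
  rw [hg]
  linarith [h.energy_ge (ha.trans ht) hδ (hle t ht)]

/-- Since `c g = L K`, the terms containing `A` cancel in the bracket, leaving `L K / c ≥ 0` with no
sign condition on `A` at later times. Length is constant, while `A' = L K / c ≥ δ² / c` eventually.
-/
theorem false_of_lengthPreserving (h : IsEvolution c L A I K g) (hc : 0 < c)
    (hg : ∀ t, g t = L t * c⁻¹ * K t) (hA : 0 < A 0) (hI : I 0 = 0) (hK : 0 < K 0) : False := by
  obtain ⟨a, δ, ha, hδ, hle⟩ := h.exists_deficit_le hc (fun t ht => by
    have h1 := h.length_pos t ht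
    have h2 := h.energy_nonneg t ht
    have e : g t * I t + 2 * A t / L t * K t = L t * c⁻¹ * K t := by
      rw [hg, h.deficit_eq]
      field_simp
      ring
    rw [e]
    positivity) hA hI hK
  have hL : ∀ t, 0 ≤ t → L t ^ 2 ≤ L 0 ^ 2 := fun t ht => by
    have := le_add_mul_of_hasDerivWithinAt_le (c := 0) le_rfl h.length_sq_deriv
      (fun s _ => le_of_eq (by rw [hg]; field_simp; ring)) ht
    linarith
  -- The crude bound `A ≤ L² / 2 ≤ L(0)² / 2` makes this function positive, the `+ 1` giving
  -- strictness.
  refine false_of_pos_of_hasDerivWithinAt_le_neg (c := c⁻¹ * δ ^ 2)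
    (y := fun t => L 0 ^ 2 / 2 + 1 - A t) ha (by positivity)
    (fun t ht => (h.area_deriv t ht).const_sub _)
    (fun t ht => by linarith [h.area_le t ht, hL t ht]) fun t ht => ?_
  have := mul_le_mul_of_nonneg_left (h.energy_ge (ha.trans ht) hδ (hle t ht))
    (inv_pos.2 hc).le
  rw [hg]
  linarith

/-- Here `g = (L² / 2A) I`, so `g I ≥ 0`, and once `I ≤ -δ` the term `2 c g` alone drives `L²` down.
-/
theorem false_of_jiangPan (h : IsEvolution c L A I K g) (hc : 0 < c)
    (hg : ∀ t, g t = L t ^ 2 / (2 * A t) - c) (hA : ∀ t, 0 ≤ t → 0 < A t) (hI : I 0 = 0)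
    (hK : 0 < K 0) : False := by
  have hgI : ∀ t, 0 ≤ t → g t = L t ^ 2 / (2 * A t) * I t := fun t ht => by
    have h1 := h.length_pos t ht
    have h3 := hA t ht
    rw [hg, h.deficit_eq]
    field_simp
  obtain ⟨a, δ, ha, hδ, hle⟩ := h.exists_deficit_le hc (fun t ht => by
    have h1 := h.length_pos t ht
    have h2 := h.energy_nonneg t ht
    have h3 := hA t ht
    rw [hgI t ht, mul_assoc]
    have := mul_self_nonneg (I t)
    positivity) (hA 0 le_rfl) hI hK
  refine false_of_pos_of_hasDerivWithinAt_le_neg (c := 2 * c * δ) ha (by positivity)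
    h.length_sq_deriv (fun t ht => pow_pos (h.length_pos t ht) 2) fun t ht => ?_
  have ht0 := ha.trans ht
  have h1 := h.length_pos t ht0
  have h2 := h.energy_nonneg t ht0
  have h3 := hA t ht0
  -- The crude isoperimetric inequality passes the bound `I ≤ -δ` on to `g` without loss.
  have h4 : 1 ≤ L t ^ 2 / (2 * A t) := by
    rw [one_le_div (by positivity)]
    linarith [h.area_le t ht0]
  have h5 : g t ≤ -δ := by
    rw [hgI t ht0]
    nlinarith [hle t ht]
  have h6 := mul_nonneg h1.le h2
  nlinarith

end IsEvolution

/-! ### From a global solution to the contradiction -/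

/-- Freezing a global solution at its initial value for negative times. -/
theorem IsClassicalSolution.isContinuousFamily {F : FlowType} {f : ℝ → ℝ → ℂ}
    (hf : IsClassicalSolution F ⊤ f) : IsContinuousFamily fun t => f (max t 0) := by
  have hm : ∀ t : ℝ, max t 0 ∈ timeInterval ⊤ := fun t =>
    ⟨le_max_right _ _, EReal.coe_lt_top _⟩
  refine ⟨fun t => ⟨hf.periodic _ (hm t), hf.contDiff _ (hm t), hf.immersed _ (hm t)⟩,
    fun k hk => ?_⟩
  exact (hf.continuousOn k hk).comp_continuous
    (f := fun p : ℝ × ℝ => ((max p.1 0, p.2) : ℝ × ℝ)) (by fun_prop)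
    fun p => ⟨hm p.1, Set.mem_univ _⟩

theorem IsClassicalSolution.isEvolution {F : FlowType} {f : ℝ → ℝ → ℂ}
    (hf : IsClassicalSolution F ⊤ f) :
    IsEvolution (totalCurvature (f 0)) (fun t => length (f (max t 0)))
      (fun t => area (f (max t 0))) (fun t => isoperimetricDeficit (f (max t 0)))
      (fun t => arcIntegral (f (max t 0)) (fun u => curvatureDeviation (f (max t 0)) u ^ 2))
      (fun t => forcing F (f (max t 0))) := by
  have h := hf.isContinuousFamily
  have hm : ∀ t : ℝ, max t 0 ∈ timeInterval ⊤ := fun t =>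
    ⟨le_max_right _ _, EReal.coe_lt_top _⟩
  have hc : ∀ t, totalCurvature (f (max t 0)) = totalCurvature (f 0) := fun t => by
    simpa using h.totalCurvature_eq t 0
  have hφ : ∀ t, 0 ≤ t → ∀ u, HasDerivWithinAt (fun s => f (max s 0) u)
      (velocity F (f (max t 0)) u) (Set.Ici 0) t := fun t ht u => by
    have := hf.equation _ (hm t) u
    rw [max_eq_left ht] at this ⊢
    exact this.congr (fun s hs => by rw [max_eq_left hs]) (by rw [max_eq_left ht])
  have cw : Continuous fun p : ℝ × ℝ => velocity F (f (max p.1 0)) p.2 := by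
    have c1 := h.continuous_forcing fun t => hf.forcingDefined _ (hm t)
    have c2 := c1.div h.continuous_length fun t => (h.immersion t).length_pos.ne'
    exact (h.continuous_curvatureDeviation.sub (c2.comp continuous_fst)).smul h.continuous_normal
  refine ⟨fun t _ => (h.immersion t).length_pos, fun t _ => (h.immersion t).arcIntegral_sq_nonneg _,
    fun t => ?_, fun t _ => (h.immersion t).sq_isoperimetricDeficit_le,
    fun t _ => (h.immersion t).area_le, fun t ht => ?_, fun t ht => ?_⟩
  · rw [isoperimetricDeficit_eq, hc]
  · refine (h.hasDerivWithinAt_length (w := fun t => velocity F (f (max t 0))) hφ cw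
      ht).congr_deriv ?_
    rw [(h.immersion t).integral_inner_curvature_velocity, hc]
  · refine (h.hasDerivWithinAt_area (w := fun t => velocity F (f (max t 0))) hφ cw
      ht).congr_deriv ?_
    rw [(h.immersion t).integral_inner_deriv_velocity, neg_neg]

theorem IsClassicalSolution.false_of_deficit_eq_zero {F : FlowType} {f : ℝ → ℝ → ℂ}
    (hf : IsClassicalSolution F ⊤ f) {n : ℕ} (hn : 1 ≤ n) (hrot : rotationNumber (f 0) = n)
    (hA : 0 < area (f 0)) (hI : isoperimetricDeficit (f 0) = 0)
    (hcircle : ¬ IsFoldCircle n (f 0)) : False := by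
  have h := hf.isContinuousFamily
  have hE := hf.isEvolution
  have hm : ∀ t : ℝ, max t 0 ∈ timeInterval ⊤ := fun t =>
    ⟨le_max_right _ _, EReal.coe_lt_top _⟩
  have hc : totalCurvature (f 0) = 2 * Real.pi * n := by
    rw [← hrot, rotationNumber]
    field_simp
  have hcpos : 0 < totalCurvature (f 0) := by
    have : (0 : ℝ) < n := by exact_mod_cast hn
    rw [hc]
    positivity
  have hct : ∀ t, totalCurvature (f (max t 0)) = totalCurvature (f 0) := fun t => by
    simpa using h.totalCurvature_eq t 0
  have h0 : max (0 : ℝ) 0 = 0 := max_self 0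
  have hK : 0 < arcIntegral (f (max 0 0)) (fun u => curvatureDeviation (f (max 0 0)) u ^ 2) := by
    have him := h.immersion 0
    rw [h0] at him ⊢
    exact him.arcIntegral_sq_curvatureDeviation_pos hn hc hcircle
  have hA0 : 0 < area (f (max 0 0)) := by rwa [h0]
  have hI0 : isoperimetricDeficit (f (max 0 0)) = 0 := by rwa [h0]
  cases F with
  | AP => exact hE.false_of_areaPreserving hcpos (fun _ => rfl) hA0 hI0 hK
  | LP =>
    exact hE.false_of_lengthPreserving hcpos (fun t => by simp only [forcing, hct]) hA0 hI0 hK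
  | JP =>
    refine hE.false_of_jiangPan hcpos (fun t => by simp only [forcing, hct]) (fun t _ => ?_) hI0 hK
    -- Area never vanishes along (JP), since `g` is defined, so by the intermediate value theorem it
    -- keeps its initial sign.
    by_contra hneg
    obtain ⟨s, hs⟩ := mem_range_of_exists_le_of_exists_ge h.continuous_area
      ⟨t, not_lt.1 hneg⟩ ⟨0, hA0.le⟩
    exact hf.forcingDefined _ (hm s) hs

end CurveFlow

theorem mainTheorem7 (F : CurveFlow.FlowType) (T : EReal) (f : ℝ → ℝ → ℂ)
    (hf : CurveFlow.IsMaximalSolution F T f)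
    (n : ℕ) (hn : 1 ≤ n) (hrot : CurveFlow.rotationNumber (f 0) = n)
    (hsmooth : ContDiff ℝ ∞ (f 0))
    (hA : 0 < CurveFlow.area (f 0))
    (hI : CurveFlow.isoperimetricDeficit (f 0) = 0)
    (hcircle : ¬ CurveFlow.IsFoldCircle n (f 0)) :
    T < ⊤ := by
  rw [lt_top_iff_ne_top]
  rintro rfl
  exact hf.solution.false_of_deficit_eq_zero hn hrot hA hI hcircle
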